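/- Let $\alpha>0$ be fixed and let $p_0$ be a positive integer. For every prime $p\ge p_0$ and every $n\ge 1$ let $M_{n,p}$ be a random $n\times n$ matrix with entries in $\mathbb F_p$ which are independent and identically distributed copies of an $\alpha$-balanced random variable $\xi$ in $\mathbb F_p$, that is, $\max_{a\in\mathbb F_p}\mathbb P(\xi=a)\le 1-\alpha$ (the law of $\xi$ may depend on $p$ and $n$, while $\alpha$ does not). Then for every prime $p\ge p_0$ the limit $\lim_{n\to\infty}\mathbb P(M_{n,p}\text{ has no eigenvalue in }\mathbb F_p)$ exists, and, as $p$ tends to infinity along the primes, $$\lim_{p\to\infty}\ \lim_{n\to\infty}\mathbb P(M_{n,p}\text{ has no eigenvalue in }\mathbb F_p)=\frac1e .$$ -/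

import Mathlib

open Filter Topology MeasureTheory ProbabilityTheory

/-- A random variable `ξ` with values in `𝔽_p`, on a space with probability measure `P`, is
`α`-balanced if `max_a P(ξ = a) ≤ 1 - α`. -/
def IsBalanced {Ω : Type*} [MeasurableSpace Ω] {p : ℕ} (α : ℝ) (P : Measure Ω)
    (ξ : Ω → ZMod p) : Prop :=
  ∀ a : ZMod p, P.real {ω | ξ ω = a} ≤ 1 - α

/-- `M` is a random `n × n` matrix over `𝔽_p` whose entries are iid copies of an `α`-balanced
random variable: they are (measurable,) mutually independent, have the same law, and this law is
`α`-balanced. -/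
structure IsIIDBalancedMatrix {Ω : Type*} [MeasurableSpace Ω] {p n : ℕ} (α : ℝ) (P : Measure Ω)
    (M : Ω → Matrix (Fin n) (Fin n) (ZMod p)) : Prop where
  isProbabilityMeasure : IsProbabilityMeasure P
  measurable : ∀ i j, Measurable fun ω => M ω i j
  independent : iIndepFun (fun (e : Fin n × Fin n) (ω : Ω) => M ω e.1 e.2) P
  identDistrib : ∀ i j k l, IdentDistrib (fun ω => M ω i j) (fun ω => M ω k l) P P
  balanced : ∀ i j, IsBalanced α P fun ω => M ω i j

/-- A matrix over `𝔽_p` is eigenvalue-free if no element of `𝔽_p` is an eigenvalue of it. -/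
def IsEigenvalueFree {p n : ℕ} (A : Matrix (Fin n) (Fin n) (ZMod p)) : Prop :=
  ∀ a : ZMod p, ¬ Module.End.HasEigenvalue (Matrix.toLin' A) a

/-! The proof is a moment computation followed by a sieve. For a fixed square matrix `T` of size
`k`, count the injective `n × k` matrices `V` with `A V = V T`. The expected count tends to 1 as `n
→ ∞` (`tendsto_expected_card_invariantFrames`), whatever the balanced law of the entries. When `T`
is diagonal with each `a` repeated `ρ a` times, the columns of `V` are independent eigenvectors, so
the count is a product over `a` of numbers of `ρ a`-frames in the eigenspaces
(`card_invariantFrames_diagonal`). All mixed frame moments of the eigenspaces therefore tend to 1.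

For the moment, the rows of `A` are independent, so the expectation is a sum over `V` of products of
row probabilities `P(m V = w)`. Put `Q = p ^ k`. Fourier inversion gives each of these as `Q⁻¹` plus
a negligible error, unless some nonzero combination of columns of `V` has few nonzero entries. The
exceptional `V` are sorted by the span `U` of the coefficient vectors of such sparse combinations.
Almost all rows of such a `V` lie in `U^⊥`, so there are about `|U^⊥|^n` of them, up to a factor
`β^n`. Each row probability is at most about `(1 - α) / |U^⊥|`, and `β (1 - α) < 1`, so their
contribution vanishes.

For the sieve, Möbius inversion over subspaces writes the indicator of a zero eigenspace as the
alternating sum of frame counts divided by `(q - 1)⋯(q^r - 1)`, and a truncation errs by at most the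
next term (`abs_indicator_sub_sum_le`). Hence the limit in `n` is `eulerSeries p ^ p`. Since
`eulerSeries p = 1 - 1/(p - 1) + O(1/p²)`, its `p`-th power tends to `1/e`. -/

/-- A probability weight on `𝔽_p` all of whose values are at most `1 - α`. -/
structure IsBalancedWeight {p : ℕ} [NeZero p] (α : ℝ) (μ : ZMod p → ℝ) : Prop where
  nonneg : ∀ a, 0 ≤ μ a
  sum_eq_one : ∑ a, μ a = 1
  le : ∀ a, μ a ≤ 1 - α

/-- The probability of a row with independent entries of law `μ`. -/
def rowWeight {p n : ℕ} (μ : ZMod p → ℝ) (m : Fin n → ZMod p) : ℝ := ∏ j, μ (m j)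

/-- The probability of a square matrix with independent entries of law `μ`. -/
def matrixWeight {p n : ℕ} (μ : ZMod p → ℝ) (A : Matrix (Fin n) (Fin n) (ZMod p)) : ℝ :=
  ∏ i, rowWeight μ (A i)

/-! ### From the random matrix to a finite weighted sum over matrices. -/

section Law

variable {Ω : Type*} [MeasurableSpace Ω] {p n : ℕ} {α : ℝ} {P : Measure Ω}
  {M : Ω → Matrix (Fin n) (Fin n) (ZMod p)}

theorem IsIIDBalancedMatrix.isBalancedWeight [NeZero p] (h : IsIIDBalancedMatrix α P M) (i : Fin n) :
    IsBalancedWeight α fun a => P.real {ω | M ω i i = a} := by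
  have := h.isProbabilityMeasure
  refine ⟨fun a => measureReal_nonneg, ?_, h.balanced i i⟩
  have hd : (↑(Finset.univ : Finset (ZMod p)) : Set (ZMod p)).PairwiseDisjoint
      fun a => {ω | M ω i i = a} := by
    intro a _ b _ hab
    refine Set.disjoint_left.2 fun ω h1 h2 => hab ?_
    exact h1.symm.trans h2
  rw [← measureReal_biUnion_finset hd fun b _ => h.measurable i i (measurableSet_singleton b)]
  have : (⋃ a ∈ (Finset.univ : Finset (ZMod p)), {ω | M ω i i = a}) = Set.univ := by
    ext ω; simp
  rw [this, probReal_univ]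

theorem IsIIDBalancedMatrix.measureReal_eq (h : IsIIDBalancedMatrix α P M) (i₀ : Fin n)
    (A : Matrix (Fin n) (Fin n) (ZMod p)) :
    P.real {ω | M ω = A} = matrixWeight (fun a => P.real {ω | M ω i₀ i₀ = a}) A := by
  have := h.isProbabilityMeasure
  have h1 := h.independent.measure_inter_preimage_eq_mul Finset.univ
    (sets := fun e => {A e.1 e.2}) fun e _ => measurableSet_singleton _
  have h2 : (⋂ e ∈ (Finset.univ : Finset (Fin n × Fin n)),
      (fun ω => M ω e.1 e.2) ⁻¹' {A e.1 e.2}) = {ω | M ω = A} := by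
    ext ω
    simp [← Matrix.ext_iff]
  rw [h2] at h1
  rw [Measure.real, h1, ENNReal.toReal_prod, Fintype.prod_prod_type]
  refine Finset.prod_congr rfl fun i _ => Finset.prod_congr rfl fun j _ => ?_
  rw [(h.identDistrib i j i₀ i₀).measure_preimage_eq (measurableSet_singleton _)]
  rfl

open Classical in
theorem IsIIDBalancedMatrix.measureReal_setOf [NeZero p] (h : IsIIDBalancedMatrix α P M) (i₀ : Fin n)
    (Q : Matrix (Fin n) (Fin n) (ZMod p) → Prop) :
    P.real {ω | Q (M ω)} =
      ∑ A, matrixWeight (fun a => P.real {ω | M ω i₀ i₀ = a}) A * if Q A then 1 else 0 := by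
  have := h.isProbabilityMeasure
  have hs : {ω | Q (M ω)} = ⋃ A ∈ Finset.univ.filter Q, {ω | M ω = A} := by
    ext ω; simp
  have hm (A : Matrix (Fin n) (Fin n) (ZMod p)) : MeasurableSet {ω | M ω = A} := by
    have : {ω | M ω = A} = ⋂ i, ⋂ j, (fun ω => M ω i j) ⁻¹' {A i j} := by
      ext ω; simp [← Matrix.ext_iff]
    rw [this]
    exact MeasurableSet.iInter fun i => MeasurableSet.iInter fun j =>
      h.measurable i j (measurableSet_singleton _)
  rw [hs, measureReal_biUnion_finset]
  · simp [Finset.sum_filter, h.measureReal_eq i₀]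
  · intro A _ B _ hAB
    exact Set.disjoint_left.2 fun ω h1 h2 => hAB (h1.symm.trans h2)
  · exact fun A _ => hm A

end Law

/-! ### Fourier transform of a balanced weight. -/

section Weights

variable {p : ℕ} [NeZero p] {α : ℝ} {μ : ZMod p → ℝ}

theorem rowWeight_nonneg (h : IsBalancedWeight α μ) {n : ℕ} (m : Fin n → ZMod p) :
    0 ≤ rowWeight μ m := Finset.prod_nonneg fun _ _ => h.nonneg _

theorem matrixWeight_nonneg (h : IsBalancedWeight α μ) {n : ℕ}
    (A : Matrix (Fin n) (Fin n) (ZMod p)) : 0 ≤ matrixWeight μ A :=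
  Finset.prod_nonneg fun _ _ => rowWeight_nonneg h _

theorem sum_rowWeight (h : IsBalancedWeight α μ) (n : ℕ) :
    ∑ m : Fin n → ZMod p, rowWeight μ m = 1 := by
  simp only [rowWeight]
  rw [← Fintype.prod_sum fun (_ : Fin n) a => μ a]
  simp [h.sum_eq_one]

theorem IsBalancedWeight.lt_one (h : IsBalancedWeight α μ) : α < 1 := by
  by_contra! hα
  have : ∑ a, μ a ≤ 0 := Finset.sum_nonpos fun a _ => (h.le a).trans (by linarith)
  linarith [h.sum_eq_one]

/-- The Fourier transform of a weight on `𝔽_p`. -/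
noncomputable def charExp (μ : ZMod p → ℝ) (y : ZMod p) : ℂ :=
  ∑ x, (μ x : ℂ) * ZMod.stdAddChar (x * y)

theorem charExp_zero (h : IsBalancedWeight α μ) : charExp μ 0 = 1 := by
  simp only [charExp, mul_zero, AddChar.map_zero_eq_one, mul_one]
  exact_mod_cast h.sum_eq_one

theorem exists_re_stdAddChar_le (p : ℕ) [Fact p.Prime] :
    ∃ c : ℝ, 0 < c ∧ ∀ k : ZMod p, k ≠ 0 → (ZMod.stdAddChar k : ℂ).re ≤ 1 - c := by
  obtain ⟨k₀, hk₀, hmin⟩ := Finset.exists_min_image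
    (Finset.univ.filter fun k : ZMod p => k ≠ 0) (fun k => 1 - (ZMod.stdAddChar k : ℂ).re)
    ⟨1, by simp⟩
  refine ⟨1 - (ZMod.stdAddChar k₀ : ℂ).re, ?_, fun k hk => ?_⟩
  · have hn : ‖(ZMod.stdAddChar k₀ : ℂ)‖ = 1 := AddChar.norm_apply _ _
    by_contra! hle
    have h1 : (ZMod.stdAddChar k₀ : ℂ).re = ‖(ZMod.stdAddChar k₀ : ℂ)‖ :=
      le_antisymm (Complex.re_le_norm _) (by linarith)
    have h2 := (Complex.re_eq_norm.1 h1)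
    have h3 : (ZMod.stdAddChar k₀ : ℂ) = 1 := by
      apply Complex.ext
      · rw [h1, hn]; simp
      · simpa using (Complex.nonneg_iff.1 h2).2.symm
    have h4 : k₀ = 0 := ZMod.injective_stdAddChar (by rw [h3, AddChar.map_zero_eq_one])
    simp [h4] at hk₀
  · have := hmin k (by simp [hk])
    linarith

/-- Expanding `‖charExp μ y‖²` as a double sum over `x, x'`, each off-diagonal term loses a factor
`1 - c`, while the diagonal has mass `∑ μ(x)² ≤ 1 - α`. The total is at most `1 - c α`. The bound
depends on `p` and `α` only, which is needed because the law may vary with `n`. -/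
theorem exists_norm_charExp_le (p : ℕ) [Fact p.Prime] {α : ℝ} (hα : 0 < α) :
    ∃ θ : ℝ, 0 < θ ∧ θ < 1 ∧ ∀ μ : ZMod p → ℝ, IsBalancedWeight α μ →
      ∀ y, y ≠ 0 → ‖charExp μ y‖ ≤ θ := by
  obtain ⟨c, hc, hre⟩ := exists_re_stdAddChar_le p
  -- The maximum with `1 / 2` only keeps `θ` positive, for use as the base of real powers.
  refine ⟨max (1 / 2) (Real.sqrt (1 - c * α)), by positivity, ?_, fun μ hμ y hy => ?_⟩
  · refine max_lt (by norm_num) ?_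
    rw [Real.sqrt_lt' one_pos]
    nlinarith [mul_pos hc hα]
  · refine le_trans (Real.le_sqrt_of_sq_le ?_) (le_max_right _ _)
    have h1 : ((‖charExp μ y‖ ^ 2 : ℝ) : ℂ) =
        ∑ x, ∑ x', ((μ x * μ x' : ℝ) : ℂ) * ZMod.stdAddChar ((x - x') * y) := by
      rw [Complex.ofReal_pow, ← Complex.mul_conj', charExp, map_sum, Finset.sum_mul_sum]
      refine Finset.sum_congr rfl fun x _ => Finset.sum_congr rfl fun x' _ => ?_
      rw [map_mul (starRingEnd ℂ), Complex.conj_ofReal, ← AddChar.map_neg_eq_conj, sub_mul, sub_eq_add_neg,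
        AddChar.map_add_eq_mul]
      push_cast
      ring
    have h2 : ‖charExp μ y‖ ^ 2 =
        ∑ x, ∑ x', μ x * μ x' * (ZMod.stdAddChar ((x - x') * y) : ℂ).re := by
      have := congrArg Complex.re h1
      simpa only [Complex.ofReal_re, Complex.re_sum, Complex.re_ofReal_mul] using this
    rw [h2]
    have h3 : ∀ x x', μ x * μ x' * (ZMod.stdAddChar ((x - x') * y) : ℂ).re ≤
        (1 - c) * (μ x * μ x') + c * (if x = x' then μ x * μ x' else 0) := by
      intro x x'
      have h0 := mul_nonneg (hμ.nonneg x) (hμ.nonneg x')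
      split_ifs with hx
      · subst hx; simp; linarith
      · have := hre ((x - x') * y) (mul_ne_zero (sub_ne_zero.2 hx) hy)
        nlinarith
    refine (Finset.sum_le_sum fun x _ => Finset.sum_le_sum fun x' _ => h3 x x').trans ?_
    simp only [Finset.sum_add_distrib, ← Finset.mul_sum, Finset.sum_ite_eq, Finset.mem_univ,
      if_true, hμ.sum_eq_one, mul_one]
    have h4 : ∑ x, μ x * μ x ≤ ∑ x, μ x * (1 - α) :=
      Finset.sum_le_sum fun x _ => mul_le_mul_of_nonneg_left (hμ.le x) (hμ.nonneg x)
    rw [← Finset.sum_mul, hμ.sum_eq_one] at h4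
    nlinarith

theorem map_sum_eq_prod_stdAddChar {ι : Type*} [Fintype ι] (f : ι → ZMod p) :
    (ZMod.stdAddChar (∑ i, f i) : ℂ) = ∏ i, ZMod.stdAddChar (f i) :=
  map_prod (ZMod.stdAddChar (N := p)).toMonoidHom (fun i => Multiplicative.ofAdd (f i)) _

theorem sum_rowWeight_mul_stdAddChar {n : ℕ} (μ : ZMod p → ℝ) (y : Fin n → ZMod p) :
    ∑ m : Fin n → ZMod p, (rowWeight μ m : ℂ) * ZMod.stdAddChar (m ⬝ᵥ y) =
      ∏ j, charExp μ (y j) := by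
  simp only [charExp]
  rw [Fintype.prod_sum fun j x => (μ x : ℂ) * ZMod.stdAddChar (x * y j)]
  refine Finset.sum_congr rfl fun m _ => ?_
  rw [Finset.prod_mul_distrib, rowWeight, Complex.ofReal_prod, dotProduct]
  congr 1
  exact map_sum_eq_prod_stdAddChar _

theorem norm_prod_charExp_le {n : ℕ} (h : IsBalancedWeight α μ) {θ : ℝ}
    (hθ : ∀ y, y ≠ 0 → ‖charExp μ y‖ ≤ θ) (y : Fin n → ZMod p) :
    ‖∏ j, charExp μ (y j)‖ ≤ θ ^ hammingNorm y := by
  rw [norm_prod, hammingNorm, ← Finset.prod_const, Finset.prod_filter]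
  refine Finset.prod_le_prod (fun _ _ => norm_nonneg _) fun j _ => ?_
  split_ifs with hj
  · exact hθ _ hj
  · rw [not_not.1 hj, charExp_zero h, norm_one]

end Weights

/-! ### Fourier inversion for row probabilities, relative to a subspace of frequencies. -/

section Fourier

open scoped Classical Matrix

variable {p : ℕ} [Fact p.Prime] {ι : Type*} [Fintype ι]

/-- The elements of a subspace of `𝔽_p^ι`, as a finset. -/
noncomputable def subspaceFinset (U : Submodule (ZMod p) (ι → ZMod p)) : Finset (ι → ZMod p) :=
  Finset.univ.filter (· ∈ U)

/-- The vectors orthogonal to a subspace of `𝔽_p^ι`. -/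
noncomputable def orthFinset (U : Submodule (ZMod p) (ι → ZMod p)) : Finset (ι → ZMod p) :=
  Finset.univ.filter fun z => ∀ c ∈ U, c ⬝ᵥ z = 0

@[simp] theorem mem_subspaceFinset {U : Submodule (ZMod p) (ι → ZMod p)} {c : ι → ZMod p} :
    c ∈ subspaceFinset U ↔ c ∈ U := by simp [subspaceFinset]

@[simp] theorem mem_orthFinset {U : Submodule (ZMod p) (ι → ZMod p)} {z : ι → ZMod p} :
    z ∈ orthFinset U ↔ ∀ c ∈ U, c ⬝ᵥ z = 0 := by simp [orthFinset]

theorem card_subspaceFinset_pos (U : Submodule (ZMod p) (ι → ZMod p)) :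
    0 < (subspaceFinset U).card := Finset.card_pos.2 ⟨0, by simp⟩

theorem card_subspaceFinset_bot :
    (subspaceFinset (⊥ : Submodule (ZMod p) (ι → ZMod p))).card = 1 := by
  rw [Finset.card_eq_one]
  exact ⟨0, by ext; simp⟩

theorem two_le_card_subspaceFinset {U : Submodule (ZMod p) (ι → ZMod p)} (hU : U ≠ ⊥) :
    2 ≤ (subspaceFinset U).card := by
  obtain ⟨c, hc, hc0⟩ := Submodule.exists_mem_ne_zero_of_ne_bot hU
  exact Finset.one_lt_card.2 ⟨c, by simpa using hc, 0, by simp, hc0⟩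

theorem sum_stdAddChar_subspace (U : Submodule (ZMod p) (ι → ZMod p)) (z : ι → ZMod p) :
    ∑ c ∈ subspaceFinset U, (ZMod.stdAddChar (c ⬝ᵥ z) : ℂ) =
      if z ∈ orthFinset U then ((subspaceFinset U).card : ℂ) else 0 := by
  split_ifs with hz
  · rw [mem_orthFinset] at hz
    rw [Finset.sum_congr rfl fun c hc => by rw [hz c (by simpa using hc)]]
    simp
  · simp only [mem_orthFinset, not_forall] at hz
    obtain ⟨c₀, hc₀, hne⟩ := hz
    have hinv : ∑ c ∈ subspaceFinset U, (ZMod.stdAddChar (c ⬝ᵥ z) : ℂ) =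
        ∑ c ∈ subspaceFinset U, (ZMod.stdAddChar ((c + c₀) ⬝ᵥ z) : ℂ) := by
      refine (Finset.sum_bij (fun c _ => c + c₀) ?_ ?_ ?_ ?_).symm
      · exact fun c hc => by simpa using U.add_mem (by simpa using hc) hc₀
      · exact fun a _ b _ h => add_right_cancel h
      · exact fun b hb => ⟨b - c₀, by simpa using U.sub_mem (by simpa using hb) hc₀, by simp⟩
      · exact fun _ _ => rfl
    simp only [add_dotProduct, AddChar.map_add_eq_mul, ← Finset.sum_mul] at hinv
    have h1 : (ZMod.stdAddChar (c₀ ⬝ᵥ z) : ℂ) ≠ 1 := fun h =>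
      hne (ZMod.injective_stdAddChar (by rw [h, AddChar.map_zero_eq_one]))
    by_contra hs
    exact h1 (mul_left_cancel₀ hs (by rw [← hinv, mul_one]))

theorem orthFinset_top : orthFinset (⊤ : Submodule (ZMod p) (ι → ZMod p)) = {0} := by
  ext z
  simp only [mem_orthFinset, Finset.mem_singleton]
  refine ⟨fun h => funext fun i => ?_, fun h => by simp [h]⟩
  simpa using h (Pi.single i 1) trivial

theorem card_subspaceFinset_mul_card_orthFinset (U : Submodule (ZMod p) (ι → ZMod p)) :
    (subspaceFinset U).card * (orthFinset U).card = p ^ Fintype.card ι := by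
  have h1 : ∑ z : ι → ZMod p, ∑ c ∈ subspaceFinset U, (ZMod.stdAddChar (c ⬝ᵥ z) : ℂ) =
      (subspaceFinset U).card * (orthFinset U).card := by
    simp only [sum_stdAddChar_subspace]
    rw [← Finset.sum_filter, Finset.sum_const, Finset.filter_mem_eq_inter, Finset.univ_inter,
      nsmul_eq_mul, mul_comm]
  have h2 : ∑ c ∈ subspaceFinset U, ∑ z : ι → ZMod p, (ZMod.stdAddChar (c ⬝ᵥ z) : ℂ) =
      (p : ℂ) ^ Fintype.card ι := by
    have (c : ι → ZMod p) : ∑ z : ι → ZMod p, (ZMod.stdAddChar (c ⬝ᵥ z) : ℂ) =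
        if c = 0 then (p : ℂ) ^ Fintype.card ι else 0 := by
      have := sum_stdAddChar_subspace ⊤ c
      rw [orthFinset_top, subspaceFinset] at this
      simpa [dotProduct_comm c, Fintype.card_fun, ZMod.card] using this
    simp [this]
  rw [Finset.sum_comm, h2] at h1
  exact_mod_cast h1.symm

variable {n : ℕ} {α : ℝ} {μ : ZMod p → ℝ}

/-- The probability that a random row `m` satisfies `c ⬝ (m V) = c ⬝ w` for all `c ∈ U`. -/
noncomputable def subspaceProb (μ : ZMod p → ℝ) (V : Matrix (Fin n) ι (ZMod p)) (w : ι → ZMod p)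
    (U : Submodule (ZMod p) (ι → ZMod p)) : ℝ :=
  ∑ m : Fin n → ZMod p, rowWeight μ m * if m ᵥ* V - w ∈ orthFinset U then 1 else 0

/-- The probability that a random row `m` satisfies `m V = w`. -/
noncomputable def rowProb (μ : ZMod p → ℝ) (V : Matrix (Fin n) ι (ZMod p)) (w : ι → ZMod p) : ℝ :=
  ∑ m : Fin n → ZMod p, rowWeight μ m * if m ᵥ* V = w then 1 else 0

theorem subspaceProb_top (V : Matrix (Fin n) ι (ZMod p)) (w : ι → ZMod p) :
    subspaceProb μ V w ⊤ = rowProb μ V w := by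
  simp [subspaceProb, rowProb, orthFinset_top, sub_eq_zero]

theorem rowProb_nonneg (h : IsBalancedWeight α μ) (V : Matrix (Fin n) ι (ZMod p))
    (w : ι → ZMod p) : 0 ≤ rowProb μ V w :=
  Finset.sum_nonneg fun m _ => mul_nonneg (rowWeight_nonneg h m) (by split_ifs <;> simp)

theorem subspaceProb_bot (h : IsBalancedWeight α μ) (V : Matrix (Fin n) ι (ZMod p))
    (w : ι → ZMod p) : subspaceProb μ V w ⊥ = 1 := by
  simp [subspaceProb, sum_rowWeight h]

theorem card_mul_subspaceProb (V : Matrix (Fin n) ι (ZMod p)) (w : ι → ZMod p)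
    (U : Submodule (ZMod p) (ι → ZMod p)) :
    ((subspaceFinset U).card : ℂ) * (subspaceProb μ V w U : ℂ) =
      ∑ c ∈ subspaceFinset U,
        (∏ j, charExp μ ((V *ᵥ c) j)) * (ZMod.stdAddChar (-(c ⬝ᵥ w)) : ℂ) := by
  simp only [← sum_rowWeight_mul_stdAddChar]
  rw [subspaceProb, Complex.ofReal_sum, Finset.mul_sum]
  simp only [Finset.sum_mul]
  rw [Finset.sum_comm]
  refine Finset.sum_congr rfl fun m _ => ?_
  have h1 := sum_stdAddChar_subspace U (m ᵥ* V - w)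
  have h2 : ((subspaceFinset U).card : ℂ) *
      ((rowWeight μ m * if m ᵥ* V - w ∈ orthFinset U then 1 else 0 : ℝ) : ℂ) =
      rowWeight μ m * if m ᵥ* V - w ∈ orthFinset U then ((subspaceFinset U).card : ℂ) else 0 := by
    split_ifs <;> push_cast <;> ring
  rw [h2, ← h1, Finset.mul_sum]
  refine Finset.sum_congr rfl fun c _ => ?_
  rw [mul_assoc, ← AddChar.map_add_eq_mul, Matrix.dotProduct_mulVec, dotProduct_sub,
    dotProduct_comm c, sub_eq_add_neg]

/-- The frequencies in `U` reassemble exactly into `subspaceProb`. Every frequency outside `U`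
contributes at most `θ ^ h₀`, and there are at most `p ^ |ι|` of them. -/
theorem abs_card_mul_rowProb_sub_le (h : IsBalancedWeight α μ) {θ h₀ : ℝ} (hθ0 : 0 < θ)
    (hθ1 : θ < 1) (hθ : ∀ y, y ≠ 0 → ‖charExp μ y‖ ≤ θ) (V : Matrix (Fin n) ι (ZMod p))
    (w : ι → ZMod p) (U : Submodule (ZMod p) (ι → ZMod p))
    (hU : ∀ c, c ∉ U → h₀ ≤ hammingNorm (V *ᵥ c)) :
    |(p : ℝ) ^ Fintype.card ι * rowProb μ V w - (subspaceFinset U).card * subspaceProb μ V w U| ≤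
      (p : ℝ) ^ Fintype.card ι * θ ^ h₀ := by
  have h1 : (((p : ℝ) ^ Fintype.card ι * rowProb μ V w -
      (subspaceFinset U).card * subspaceProb μ V w U : ℝ) : ℂ) =
      ∑ c ∈ Finset.univ.filter (· ∉ U),
        (∏ j, charExp μ ((V *ᵥ c) j)) * (ZMod.stdAddChar (-(c ⬝ᵥ w)) : ℂ) := by
    have htop := card_mul_subspaceProb (μ := μ) V w ⊤
    have hsub := card_mul_subspaceProb (μ := μ) V w U
    have hc : (subspaceFinset (⊤ : Submodule (ZMod p) (ι → ZMod p))).card =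
        p ^ Fintype.card ι := by
      simp [subspaceFinset, ZMod.card]
    rw [subspaceProb_top, hc] at htop
    push_cast at htop ⊢
    rw [htop, hsub, subspaceFinset, subspaceFinset, sub_eq_iff_eq_add, add_comm,
      Finset.sum_filter_add_sum_filter_not]
    simp
  rw [← Real.norm_eq_abs, ← Complex.norm_real, h1]
  refine (norm_sum_le _ _).trans ?_
  have h2 : ∀ c ∈ Finset.univ.filter (· ∉ U),
      ‖(∏ j, charExp μ ((V *ᵥ c) j)) * (ZMod.stdAddChar (-(c ⬝ᵥ w)) : ℂ)‖ ≤ θ ^ h₀ := by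
    intro c hc
    rw [norm_mul, AddChar.norm_apply, mul_one]
    refine (norm_prod_charExp_le h hθ _).trans ?_
    rw [← Real.rpow_natCast]
    exact Real.rpow_le_rpow_of_exponent_ge hθ0 hθ1.le (hU c (by simpa using hc))
  refine (Finset.sum_le_sum h2).trans ?_
  rw [Finset.sum_const, nsmul_eq_mul]
  refine mul_le_mul_of_nonneg_right ?_ (by positivity)
  have : (Finset.univ.filter (· ∉ U)).card ≤ p ^ Fintype.card ι := by
    refine (Finset.card_le_univ _).trans ?_
    simp [ZMod.card]
  exact_mod_cast this

/-- Fix all coordinates of `m` but one where `u` is nonzero: the equation then forces a single value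
of the remaining entry. -/
theorem sum_rowWeight_dotProduct_eq_le (h : IsBalancedWeight α μ) {u : Fin n → ZMod p}
    (hu : u ≠ 0) (a : ZMod p) :
    ∑ m : Fin n → ZMod p, rowWeight μ m * (if m ⬝ᵥ u = a then 1 else 0) ≤ 1 - α := by
  obtain ⟨j, hj⟩ := Function.ne_iff.1 hu
  obtain _ | n := n
  · exact j.elim0
  rw [← (Fin.insertNthEquiv (fun _ => ZMod p) j).sum_comp, Fintype.sum_prod_type_right]
  have key (s : Fin n → ZMod p) : ∑ x, rowWeight μ (Fin.insertNthEquiv (fun _ => ZMod p) j (x, s)) *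
      (if Fin.insertNthEquiv (fun _ => ZMod p) j (x, s) ⬝ᵥ u = a then (1 : ℝ) else 0) ≤
      rowWeight μ s * (1 - α) := by
    have h1 (x : ZMod p) : rowWeight μ (Fin.insertNthEquiv (fun _ => ZMod p) j (x, s)) =
        rowWeight μ s * μ x := by
      simp [rowWeight, Fin.prod_univ_succAbove _ j, mul_comm]
    have h2 (x : ZMod p) : Fin.insertNthEquiv (fun _ => ZMod p) j (x, s) ⬝ᵥ u = a ↔
        x = (a - ∑ i, s i * u (j.succAbove i)) / u j := by
      rw [eq_div_iff hj, eq_sub_iff_add_eq]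
      simp [dotProduct, Fin.sum_univ_succAbove _ j]
    simp only [h1, h2]
    simp only [mul_ite, mul_one, mul_zero, Finset.sum_ite_eq', Finset.mem_univ, if_true]
    exact mul_le_mul_of_nonneg_left (h.le _) (rowWeight_nonneg h s)
  refine (Finset.sum_le_sum fun s _ => key s).trans ?_
  rw [← Finset.sum_mul, sum_rowWeight h, one_mul]

theorem subspaceProb_le (h : IsBalancedWeight α μ) (V : Matrix (Fin n) ι (ZMod p))
    (w : ι → ZMod p) {U : Submodule (ZMod p) (ι → ZMod p)} {c : ι → ZMod p} (hc : c ∈ U)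
    (hV : V *ᵥ c ≠ 0) : subspaceProb μ V w U ≤ 1 - α := by
  refine le_trans (Finset.sum_le_sum fun m _ => mul_le_mul_of_nonneg_left ?_ (rowWeight_nonneg h m))
    (sum_rowWeight_dotProduct_eq_le h hV (c ⬝ᵥ w))
  split_ifs with h1 h2
  · exact le_rfl
  · refine absurd ?_ h2
    have := mem_orthFinset.1 h1 c hc
    rwa [dotProduct_sub, sub_eq_zero, dotProduct_comm, ← Matrix.dotProduct_mulVec] at this
  · exact zero_le_one
  · exact le_rfl

end Fourier

/-! ### Sparse column combinations: counting exceptional frames and bounding their probabilities. -/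

section Frames

open scoped Classical Matrix

variable {p : ℕ} [Fact p.Prime] {ι : Type*} [Fintype ι] {n : ℕ} {α : ℝ} {μ : ZMod p → ℝ}

/-- The span of the coefficient vectors whose image under `V` has at most `h` nonzero entries. -/
def lowSpan (V : Matrix (Fin n) ι (ZMod p)) (h : ℝ) : Submodule (ZMod p) (ι → ZMod p) :=
  Submodule.span (ZMod p) {c | (hammingNorm (V *ᵥ c) : ℝ) ≤ h}

/-- A row not orthogonal to the span is not orthogonal to one of its generators `c`, so it is in the
support of `V c`. There are at most `p ^ |ι|` generators, each with support of size at most `h`. -/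
theorem card_rows_notMem_orthFinset_le (V : Matrix (Fin n) ι (ZMod p)) {h : ℝ} (hh : 0 ≤ h) :
    ((Finset.univ.filter fun j => V j ∉ orthFinset (lowSpan V h)).card : ℝ) ≤
      (p : ℝ) ^ Fintype.card ι * h := by
  have hsub : (Finset.univ.filter fun j => V j ∉ orthFinset (lowSpan V h)) ⊆
      (Finset.univ.filter fun c : ι → ZMod p => (hammingNorm (V *ᵥ c) : ℝ) ≤ h).biUnion
        fun c => Finset.univ.filter fun j => (V *ᵥ c) j ≠ 0 := by
    intro j hj
    by_contra hcon
    simp only [Finset.mem_biUnion, Finset.mem_filter, Finset.mem_univ, true_and, not_exists,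
      not_and, not_not] at hcon
    refine (Finset.mem_filter.1 hj).2 (mem_orthFinset.2 fun c hc => ?_)
    induction hc using Submodule.span_induction with
    | mem x hx => exact (dotProduct_comm _ _).trans (hcon x hx)
    | zero => simp
    | add x y _ _ hx hy => rw [add_dotProduct, hx, hy, add_zero]
    | smul a x _ hx => rw [smul_dotProduct, hx, smul_zero]
  have h1 := (Finset.card_le_card hsub).trans Finset.card_biUnion_le
  have h2 : ((∑ c ∈ Finset.univ.filter fun c : ι → ZMod p => (hammingNorm (V *ᵥ c) : ℝ) ≤ h,
      (Finset.univ.filter fun j => (V *ᵥ c) j ≠ 0).card : ℕ) : ℝ) ≤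
      ∑ c ∈ Finset.univ.filter fun c : ι → ZMod p => (hammingNorm (V *ᵥ c) : ℝ) ≤ h, h := by
    push_cast
    exact Finset.sum_le_sum fun c hc => (Finset.mem_filter.1 hc).2
  have h3 : ((Finset.univ.filter fun j => V j ∉ orthFinset (lowSpan V h)).card : ℝ) ≤ _ :=
    le_trans (by exact_mod_cast h1) h2
  refine h3.trans ?_
  rw [Finset.sum_const, nsmul_eq_mul]
  refine mul_le_mul_of_nonneg_right ?_ hh
  have : (Finset.univ.filter fun c : ι → ZMod p => (hammingNorm (V *ᵥ c) : ℝ) ≤ h).card ≤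
      p ^ Fintype.card ι := (Finset.card_le_univ _).trans (by simp [ZMod.card])
  exact_mod_cast this

/-- Exponential weighting: give each row outside `orthFinset U` the weight `t ≤ 1`. As at most `p ^
|ι| * h` rows are outside, the factor `t ^ (-(p ^ |ι| * h))` makes the weight of every counted `V`
at least 1, and the total weight factors over rows. -/
theorem card_lowSpan_eq_le {h t : ℝ} (hh : 0 ≤ h) (ht0 : 0 < t) (ht1 : t ≤ 1)
    (U : Submodule (ZMod p) (ι → ZMod p)) :
    ((Finset.univ.filter fun V : Matrix (Fin n) ι (ZMod p) => lowSpan V h = U).card : ℝ) ≤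
      t ^ (-((p : ℝ) ^ Fintype.card ι * h)) *
        ((orthFinset U).card * (1 + (p : ℝ) ^ Fintype.card ι * t)) ^ n := by
  set Q : ℝ := (p : ℝ) ^ Fintype.card ι
  set g : (ι → ZMod p) → ℝ := fun v => if v ∈ orthFinset U then 1 else t
  have hg0 (v) : 0 ≤ g v := by simp only [g]; split_ifs <;> linarith
  have h1 : ((Finset.univ.filter fun V : Matrix (Fin n) ι (ZMod p) => lowSpan V h = U).card : ℝ) ≤
      ∑ V : Matrix (Fin n) ι (ZMod p), t ^ (-(Q * h)) * ∏ j, g (V j) := by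
    rw [Finset.card_filter]
    push_cast
    refine Finset.sum_le_sum fun V _ => ?_
    split_ifs with hV
    · have h2 := card_rows_notMem_orthFinset_le V hh
      rw [hV] at h2
      have h3 : ∏ j, g (V j) =
          t ^ ((Finset.univ.filter fun j => V j ∉ orthFinset U).card : ℝ) := by
        rw [Real.rpow_natCast, ← Finset.prod_const, Finset.prod_filter]
        refine Finset.prod_congr rfl fun j _ => ?_
        simp only [g, ite_not]
        congr
      rw [h3, ← Real.rpow_add ht0]
      exact Real.one_le_rpow_of_pos_of_le_one_of_nonpos ht0 ht1 (by linarith)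
    · exact mul_nonneg (by positivity) (Finset.prod_nonneg fun _ _ => hg0 _)
  have h4 : ∑ V : Matrix (Fin n) ι (ZMod p), ∏ j, g (V j) = (∑ v, g v) ^ n := by
    have := Fintype.prod_sum fun (_ : Fin n) (v : ι → ZMod p) => g v
    rw [Finset.prod_const, Finset.card_univ, Fintype.card_fin] at this
    exact this.symm
  rw [← Finset.mul_sum, h4] at h1
  refine h1.trans (mul_le_mul_of_nonneg_left ?_ (by positivity))
  refine pow_le_pow_left₀ (Finset.sum_nonneg fun _ _ => hg0 _) ?_ n
  have ho : (1 : ℝ) ≤ (orthFinset U).card := by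
    exact_mod_cast Finset.card_pos.2 ⟨0, by simp⟩
  calc ∑ v, g v ≤ ∑ v : ι → ZMod p, ((if v ∈ orthFinset U then 1 else 0) + t) :=
        Finset.sum_le_sum fun v _ => by simp only [g]; split_ifs <;> linarith
    _ = (orthFinset U).card + Q * t := by
        rw [Finset.sum_add_distrib, Finset.sum_boole, Finset.filter_mem_eq_inter,
          Finset.univ_inter, Finset.sum_const, nsmul_eq_mul]
        simp [Q, ZMod.card]
    _ ≤ _ := by nlinarith [show 0 ≤ Q * t by positivity]

/-- The injective `n × ι` matrices `V` with `A V = V T`. -/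
noncomputable def invariantFrames (T : Matrix ι ι (ZMod p)) (A : Matrix (Fin n) (Fin n) (ZMod p)) :
    Finset (Matrix (Fin n) ι (ZMod p)) :=
  Finset.univ.filter fun V => Function.Injective V.mulVec ∧ A * V = V * T

theorem mem_invariantFrames {T : Matrix ι ι (ZMod p)} {A : Matrix (Fin n) (Fin n) (ZMod p)}
    {V : Matrix (Fin n) ι (ZMod p)} :
    V ∈ invariantFrames T A ↔ Function.Injective V.mulVec ∧ A * V = V * T := by
  rw [invariantFrames, Finset.mem_filter, and_iff_right (Finset.mem_univ _)]

theorem sum_matrixWeight_mul_card_invariantFrames (μ : ZMod p → ℝ) (n : ℕ)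
    (T : Matrix ι ι (ZMod p)) :
    ∑ A : Matrix (Fin n) (Fin n) (ZMod p), matrixWeight μ A * (invariantFrames T A).card =
      ∑ V ∈ Finset.univ.filter fun V : Matrix (Fin n) ι (ZMod p) => Function.Injective V.mulVec,
        ∏ i, rowProb μ V ((V * T) i) := by
  have h1 (V : Matrix (Fin n) ι (ZMod p)) : ∏ i, rowProb μ V ((V * T) i) =
      ∑ A : Matrix (Fin n) (Fin n) (ZMod p),
        matrixWeight μ A * if A * V = V * T then 1 else 0 := by
    simp only [rowProb]
    have := Fintype.prod_sum fun (i : Fin n) (m : Fin n → ZMod p) =>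
      rowWeight μ m * if m ᵥ* V = (V * T) i then (1 : ℝ) else 0
    refine this.trans (Finset.sum_congr rfl fun A _ => ?_)
    rw [Finset.prod_mul_distrib]
    refine congrArg₂ (· * ·) rfl ?_
    by_cases hA : (show Matrix (Fin n) (Fin n) (ZMod p) from A) * V = V * T
    · rw [if_pos hA]
      exact Finset.prod_eq_one fun i _ => if_pos (congrFun hA i)
    · rw [if_neg hA]
      obtain ⟨i, hi⟩ := Function.ne_iff.1 hA
      exact Finset.prod_eq_zero (Finset.mem_univ i) (if_neg hi)
  simp only [h1]
  rw [Finset.sum_comm]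
  refine Finset.sum_congr rfl fun A _ => ?_
  rw [← Finset.mul_sum, Finset.sum_boole, invariantFrames, Finset.filter_filter]

/-- With `U = lowSpan V h`, injectivity provides `c ∈ U` with `V c ≠ 0`, which already costs a
factor `1 - α` in `subspaceProb`. Dividing by `p ^ |ι| = |U| |U^⊥|` leaves `|U^⊥|` in the
denominator, to cancel against the number of such `V`. -/
theorem prod_rowProb_le (hμ : IsBalancedWeight α μ) {θ h : ℝ} (hθ0 : 0 < θ) (hθ1 : θ < 1)
    (hθ : ∀ y, y ≠ 0 → ‖charExp μ y‖ ≤ θ) {V W : Matrix (Fin n) ι (ZMod p)}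
    (hV : Function.Injective V.mulVec) (hU : lowSpan V h ≠ ⊥) :
    ∏ i, rowProb μ V (W i) ≤
      ((1 - α + (p : ℝ) ^ Fintype.card ι * θ ^ h) / (orthFinset (lowSpan V h)).card) ^ n := by
  obtain ⟨c, hc, hc0⟩ := Submodule.exists_mem_ne_zero_of_ne_bot hU
  have hVc : V *ᵥ c ≠ 0 := fun h0 => hc0 (hV (by simpa using h0))
  have key (i : Fin n) : rowProb μ V (W i) ≤
      (1 - α + (p : ℝ) ^ Fintype.card ι * θ ^ h) / (orthFinset (lowSpan V h)).card := by
    have h1 := abs_card_mul_rowProb_sub_le hμ (h₀ := h) hθ0 hθ1 hθ V (W i) (lowSpan V h)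
      fun c hc => le_of_lt <| lt_of_not_ge fun hle => hc (Submodule.subset_span hle)
    have h2 := subspaceProb_le hμ V (W i) hc hVc
    have h3 : ((subspaceFinset (lowSpan V h)).card : ℝ) * (orthFinset (lowSpan V h)).card =
        (p : ℝ) ^ Fintype.card ι := by
      exact_mod_cast card_subspaceFinset_mul_card_orthFinset (lowSpan V h)
    have h4 : (1 : ℝ) ≤ (subspaceFinset (lowSpan V h)).card := by
      exact_mod_cast card_subspaceFinset_pos _
    have h5 : (0 : ℝ) < (orthFinset (lowSpan V h)).card := by
      exact_mod_cast Finset.card_pos.2 ⟨0, by simp⟩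
    rw [le_div_iff₀ h5]
    have h6 := (abs_le.1 h1).2
    have h7 : (0 : ℝ) ≤ (p : ℝ) ^ Fintype.card ι * θ ^ h := by positivity
    set s : ℝ := ((subspaceFinset (lowSpan V h)).card : ℝ)
    set o : ℝ := ((orthFinset (lowSpan V h)).card : ℝ)
    set e := (p : ℝ) ^ Fintype.card ι * θ ^ h
    rw [← h3] at h6
    refine le_of_mul_le_mul_left ?_ (lt_of_lt_of_le one_pos h4)
    nlinarith [mul_le_mul_of_nonneg_left h2 (zero_le_one.trans h4)]
  refine (Finset.prod_le_prod (fun i _ => rowProb_nonneg hμ _ _) fun i _ => key i).trans ?_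
  rw [Finset.prod_const, Finset.card_univ, Fintype.card_fin]

theorem abs_pow_mul_prod_rowProb_sub_one_le (hμ : IsBalancedWeight α μ) {θ h : ℝ} (hθ0 : 0 < θ)
    (hθ1 : θ < 1) (hθ : ∀ y, y ≠ 0 → ‖charExp μ y‖ ≤ θ) {V W : Matrix (Fin n) ι (ZMod p)}
    (hU : lowSpan V h = ⊥) :
    |((p : ℝ) ^ Fintype.card ι) ^ n * ∏ i, rowProb μ V (W i) - 1| ≤
      Real.exp (n * ((p : ℝ) ^ Fintype.card ι * θ ^ h)) - 1 := by
  set Q : ℝ := (p : ℝ) ^ Fintype.card ι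
  have key (i : Fin n) : ‖Q * rowProb μ V (W i) - 1‖ ≤ Q * θ ^ h := by
    have h1 := abs_card_mul_rowProb_sub_le hμ (h₀ := h) hθ0 hθ1 hθ V (W i) (lowSpan V h)
      fun c hc => le_of_lt <| lt_of_not_ge fun hle => hc (Submodule.subset_span hle)
    rw [hU, card_subspaceFinset_bot, subspaceProb_bot hμ] at h1
    simpa using h1
  have h2 := Finset.norm_prod_one_add_sub_one_le Finset.univ
    fun i => Q * rowProb μ V (W i) - 1
  simp only [add_sub_cancel] at h2
  rw [Finset.prod_mul_distrib, Finset.prod_const, Finset.card_univ, Fintype.card_fin] at h2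
  refine h2.trans (sub_le_sub_right (Real.exp_le_exp.2 ?_) 1)
  refine (Finset.sum_le_sum fun i _ => key i).trans ?_
  simp

end Frames

/-! ### The expected number of invariant frames tends to 1. -/

section Moments

open scoped Classical Matrix

variable {p : ℕ} [Fact p.Prime] {ι : Type*} [Fintype ι] {n : ℕ} {α : ℝ} {μ : ZMod p → ℝ}

theorem injective_mulVec_of_lowSpan_eq_bot {V : Matrix (Fin n) ι (ZMod p)} {h : ℝ} (hh : 0 ≤ h)
    (hV : lowSpan V h = ⊥) : Function.Injective V.mulVec := by
  intro a b hab
  have h1 : a - b ∈ lowSpan V h := by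
    refine Submodule.subset_span ?_
    have : V *ᵥ (a - b) = 0 := by
      rw [Matrix.mulVec_sub]
      exact sub_eq_zero.2 hab
    simpa [this] using hh
  rwa [hV, Submodule.mem_bot, sub_eq_zero] at h1

/-- The three error terms are: the Fourier error for the `V` with `lowSpan V h = ⊥`, the proportion
of the remaining matrices, and the contribution of the injective ones among these. -/
theorem abs_expected_card_invariantFrames_sub_one_le (hμ : IsBalancedWeight α μ) {θ t β η : ℝ}
    (hθ0 : 0 < θ) (hθ1 : θ < 1) (hθ : ∀ y, y ≠ 0 → ‖charExp μ y‖ ≤ θ) (ht0 : 0 < t) (ht1 : t ≤ 1)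
    (hη : 0 ≤ η)
    (hβ : t ^ (-((p : ℝ) ^ Fintype.card ι * η)) * (1 + (p : ℝ) ^ Fintype.card ι * t) ≤ β)
    (T : Matrix ι ι (ZMod p)) :
    |∑ A : Matrix (Fin n) (Fin n) (ZMod p), matrixWeight μ A * (invariantFrames T A).card - 1| ≤
      (Real.exp (n * ((p : ℝ) ^ Fintype.card ι * θ ^ (η * n))) - 1) +
      Nat.card (Submodule (ZMod p) (ι → ZMod p)) * (β / 2) ^ n +
      Nat.card (Submodule (ZMod p) (ι → ZMod p)) *
        (β * (1 - α + (p : ℝ) ^ Fintype.card ι * θ ^ (η * n))) ^ n := by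
  have := Fintype.ofFinite (Submodule (ZMod p) (ι → ZMod p))
  set Q : ℝ := (p : ℝ) ^ Fintype.card ι with hQ
  have hQ0 : 0 < Q := pow_pos (by exact_mod_cast (Fact.out : p.Prime).pos) _
  set h : ℝ := η * n
  set ε : ℝ := Q * θ ^ h with hε
  have hε0 : 0 ≤ ε := by positivity
  have hh : 0 ≤ h := by positivity
  have hα := hμ.lt_one
  have hβ0 : 0 ≤ β := le_trans (by positivity) hβ
  set C : Submodule (ZMod p) (ι → ZMod p) → Finset (Matrix (Fin n) ι (ZMod p)) :=
    fun U => Finset.univ.filter fun V => lowSpan V h = U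
  set N : ℝ := (Nat.card (Submodule (ZMod p) (ι → ZMod p)) : ℝ) with hN
  have hNcard : (((Finset.univ : Finset (Submodule (ZMod p) (ι → ZMod p))).erase ⊥).card : ℝ) ≤
      N := by
    rw [hN, Nat.card_eq_fintype_card]
    exact_mod_cast Finset.card_le_univ _
  have hC (U) : ((C U).card : ℝ) ≤ ((orthFinset U).card * β) ^ n := by
    refine (card_lowSpan_eq_le hh ht0 ht1 U).trans ?_
    have : t ^ (-(Q * h)) = (t ^ (-(Q * η))) ^ n := by
      rw [← Real.rpow_mul_natCast ht0.le]
      congr 1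
      simp only [h]
      ring
    rw [← hQ, this, ← mul_pow]
    refine pow_le_pow_left₀ (by positivity) ?_ n
    calc _ = (orthFinset U).card * (t ^ (-(Q * η)) * (1 + Q * t)) := by ring
      _ ≤ _ := mul_le_mul_of_nonneg_left hβ (by positivity)
  have ho (U : Submodule (ZMod p) (ι → ZMod p)) : (0 : ℝ) < (orthFinset U).card := by
    exact_mod_cast Finset.card_pos.2 ⟨0, by simp⟩
  set f : Matrix (Fin n) ι (ZMod p) → ℝ := fun V => ∏ i, rowProb μ V ((V * T) i)
  have hf0 (V) : 0 ≤ f V := Finset.prod_nonneg fun _ _ => rowProb_nonneg hμ _ _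
  set I : Finset (Matrix (Fin n) ι (ZMod p)) :=
    Finset.univ.filter fun V => Function.Injective V.mulVec
  have hsum : ∑ V ∈ I, f V = ∑ V ∈ C ⊥, f V +
      ∑ U ∈ Finset.univ.erase ⊥, ∑ V ∈ I.filter fun V => lowSpan V h = U, f V := by
    rw [← Finset.sum_fiberwise I fun V => lowSpan V h, ← Finset.add_sum_erase _ _
      (Finset.mem_univ ⊥)]
    congr 2
    ext V
    simp only [I, C, Finset.mem_filter, Finset.mem_univ, true_and, and_iff_right_iff_imp]
    exact injective_mulVec_of_lowSpan_eq_bot hh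
  have hcard : ((C ⊥).card : ℝ) + ∑ U ∈ Finset.univ.erase ⊥, ((C U).card : ℝ) = Q ^ n := by
    rw [Finset.add_sum_erase _ (fun U => ((C U).card : ℝ)) (Finset.mem_univ ⊥)]
    have h1 := Finset.card_eq_sum_card_fiberwise (s := Finset.univ) (t := Finset.univ)
      (f := fun V : Matrix (Fin n) ι (ZMod p) => lowSpan V h) fun _ _ => by simp
    have h2 : (Finset.univ : Finset (Matrix (Fin n) ι (ZMod p))).card =
        (p ^ Fintype.card ι) ^ n := by
      change Fintype.card (Fin n → ι → ZMod p) = _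
      simp [ZMod.card]
    rw [h2] at h1
    rw [hQ]
    exact_mod_cast h1.symm
  have hmain : |∑ V ∈ C ⊥, f V - (C ⊥).card / Q ^ n| ≤ Real.exp (n * ε) - 1 := by
    have h1 : ∑ V ∈ C ⊥, f V - (C ⊥).card / Q ^ n = ∑ V ∈ C ⊥, (Q ^ n * f V - 1) / Q ^ n := by
      rw [← Finset.sum_div, Finset.sum_sub_distrib, ← Finset.mul_sum, sub_div,
        mul_div_cancel_left₀ _ (by positivity)]
      simp
    rw [h1]
    have h2 : ∀ V ∈ C ⊥, |(Q ^ n * f V - 1) / Q ^ n| ≤ (Real.exp (n * ε) - 1) / Q ^ n := by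
      intro V hV
      rw [abs_div, abs_of_pos (show 0 < Q ^ n by positivity)]
      exact div_le_div_of_nonneg_right (abs_pow_mul_prod_rowProb_sub_one_le hμ hθ0 hθ1 hθ
        (Finset.mem_filter.1 hV).2) (by positivity)
    refine (Finset.abs_sum_le_sum_abs _ _).trans ((Finset.sum_le_sum h2).trans ?_)
    rw [Finset.sum_const, nsmul_eq_mul, mul_div_assoc', div_le_iff₀ (by positivity), mul_comm]
    refine mul_le_mul_of_nonneg_left ?_ (sub_nonneg.2 (Real.one_le_exp (by positivity)))
    rw [← hcard]
    exact le_add_of_nonneg_right (Finset.sum_nonneg fun _ _ => by positivity)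
  have hcodes : |((C ⊥).card : ℝ) / Q ^ n - 1| ≤ N * (β / 2) ^ n := by
    have h1 : ((C ⊥).card : ℝ) / Q ^ n - 1 = -∑ U ∈ Finset.univ.erase ⊥, (C U).card / Q ^ n := by
      rw [← Finset.sum_div, div_sub_one (by positivity), ← neg_div, ← hcard]
      congr 1
      ring
    rw [h1, abs_neg, abs_of_nonneg (Finset.sum_nonneg fun _ _ => by positivity)]
    -- Here `|U^⊥| / Q = 1 / |U| ≤ 1 / 2`, because `U` is nonzero.
    have h2 : ∀ U ∈ Finset.univ.erase ⊥, ((C U).card : ℝ) / Q ^ n ≤ (β / 2) ^ n := by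
      intro U hU
      rw [div_le_iff₀ (by positivity), ← mul_pow]
      refine (hC U).trans (pow_le_pow_left₀ (by positivity) ?_ n)
      have h3 : ((subspaceFinset U).card : ℝ) * (orthFinset U).card = Q := by
        rw [hQ]
        exact_mod_cast card_subspaceFinset_mul_card_orthFinset U
      have h4 : (2 : ℝ) ≤ (subspaceFinset U).card := by
        exact_mod_cast two_le_card_subspaceFinset (Finset.ne_of_mem_erase hU)
      rw [← h3]
      nlinarith [mul_nonneg hβ0 (ho U).le]
    refine (Finset.sum_le_sum h2).trans ?_
    rw [Finset.sum_const, nsmul_eq_mul]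
    exact mul_le_mul_of_nonneg_right hNcard (by positivity)
  have hrest0 : 0 ≤ ∑ U ∈ Finset.univ.erase ⊥,
      ∑ V ∈ I.filter fun V => lowSpan V h = U, f V :=
    Finset.sum_nonneg fun _ _ => Finset.sum_nonneg fun _ _ => hf0 _
  have hrest : ∑ U ∈ Finset.univ.erase ⊥, ∑ V ∈ I.filter fun V => lowSpan V h = U, f V ≤
      N * (β * (1 - α + ε)) ^ n := by
    have h2 : ∀ U ∈ Finset.univ.erase ⊥, ∑ V ∈ I.filter fun V => lowSpan V h = U, f V ≤
        (β * (1 - α + ε)) ^ n := by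
      intro U hU
      have h3 : ∀ V ∈ I.filter fun V => lowSpan V h = U,
          f V ≤ ((1 - α + ε) / (orthFinset U).card) ^ n := by
        intro V hV
        simp only [I, Finset.mem_filter, Finset.mem_univ, true_and] at hV
        have := prod_rowProb_le hμ (h := h) (W := V * T) hθ0 hθ1 hθ hV.1
          (by rw [hV.2]; exact Finset.ne_of_mem_erase hU)
        rwa [hV.2] at this
      refine (Finset.sum_le_sum h3).trans ?_
      rw [Finset.sum_const, nsmul_eq_mul]
      have h4 : 0 ≤ (1 - α + ε) / (orthFinset U).card :=
        div_nonneg (by linarith) (ho U).le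
      have h5 : ((I.filter fun V => lowSpan V h = U).card : ℝ) ≤ (C U).card := by
        exact_mod_cast Finset.card_le_card (Finset.filter_subset_filter _ (Finset.subset_univ _))
      refine (mul_le_mul_of_nonneg_right (h5.trans (hC U)) (pow_nonneg h4 n)).trans ?_
      rw [← mul_pow]
      refine le_of_eq (congrArg (· ^ n) ?_)
      field_simp [(ho U).ne']
    refine (Finset.sum_le_sum h2).trans ?_
    rw [Finset.sum_const, nsmul_eq_mul]
    exact mul_le_mul_of_nonneg_right hNcard
      (pow_nonneg (mul_nonneg hβ0 (by linarith)) n)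
  rw [sum_matrixWeight_mul_card_invariantFrames, hsum]
  rw [abs_le] at hmain hcodes ⊢
  constructor <;> linarith [hmain.1, hmain.2, hcodes.1, hcodes.2]

/-- First `t` is taken small enough for `1 + Q t < β`; then `η → 0` sends the other factor to 1. -/
theorem exists_rpow_mul_le {Q β : ℝ} (hQ : 0 < Q) (hβ : 1 < β) :
    ∃ t η : ℝ, 0 < t ∧ t ≤ 1 ∧ 0 < η ∧ t ^ (-(Q * η)) * (1 + Q * t) ≤ β := by
  obtain ⟨t, ht0, ht1, ht⟩ : ∃ t : ℝ, 0 < t ∧ t ≤ 1 ∧ 1 + Q * t < β := by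
    refine ⟨min 1 ((β - 1) / (2 * Q)), lt_min one_pos (div_pos (by linarith) (by linarith)),
      min_le_left _ _, ?_⟩
    have : Q * min 1 ((β - 1) / (2 * Q)) ≤ Q * ((β - 1) / (2 * Q)) :=
      mul_le_mul_of_nonneg_left (min_le_right _ _) hQ.le
    have h2 : Q * ((β - 1) / (2 * Q)) = (β - 1) / 2 := by field_simp
    linarith
  have hc : Tendsto (fun η : ℝ => t ^ (-(Q * η)) * (1 + Q * t)) (𝓝[>] 0)
      (𝓝 (t ^ (-(Q * 0)) * (1 + Q * t))) := by
    refine (Continuous.tendsto ?_ 0).mono_left nhdsWithin_le_nhds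
    exact ((Real.continuous_const_rpow ht0.ne').comp (by fun_prop)).mul continuous_const
  simp only [mul_zero, neg_zero, Real.rpow_zero, one_mul] at hc
  obtain ⟨η, h1, h2⟩ := ((hc.eventually (gt_mem_nhds ht)).and self_mem_nhdsWithin).exists
  exact ⟨t, η, ht0, ht1, h2, h1.le⟩

theorem tendsto_expected_card_invariantFrames {α : ℝ} (hα : 0 < α) (μ : ℕ → ZMod p → ℝ)
    (hμ : ∀ n, 1 ≤ n → IsBalancedWeight α (μ n)) (T : Matrix ι ι (ZMod p)) :
    Tendsto (fun n : ℕ => ∑ A : Matrix (Fin n) (Fin n) (ZMod p),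
      matrixWeight (μ n) A * (invariantFrames T A).card) atTop (𝓝 1) := by
  have hα1 := (hμ 1 le_rfl).lt_one
  obtain ⟨θ, hθ0, hθ1, hθ⟩ := exists_norm_charExp_le p hα
  have hQ : (0 : ℝ) < (p : ℝ) ^ Fintype.card ι :=
    pow_pos (by exact_mod_cast (Fact.out : p.Prime).pos) _
  -- The choice `β = 1 + α / 2` ensures both `β / 2 < 1` and `β (1 - α) < 1`, the two conditions for
  -- geometric decay.
  obtain ⟨t, η, ht0, ht1, hη, hβ⟩ :=
    exists_rpow_mul_le hQ (show 1 < 1 + α / 2 by linarith)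
  set Q := (p : ℝ) ^ Fintype.card ι
  set β := 1 + α / 2 with hβdef
  have hr0 : 0 < θ ^ η := Real.rpow_pos_of_pos hθ0 _
  have hr1 : θ ^ η < 1 := Real.rpow_lt_one hθ0.le hθ1 hη
  have hpow (n : ℕ) : θ ^ (η * n) = (θ ^ η) ^ n := by
    rw [Real.rpow_mul hθ0.le, Real.rpow_natCast]
  have h1 : Tendsto (fun n : ℕ => Real.exp (n * (Q * θ ^ (η * n))) - 1) atTop (𝓝 0) := by
    have h0 := (tendsto_pow_const_mul_const_pow_of_abs_lt_one 1
      (show |θ ^ η| < 1 by rwa [abs_of_pos hr0])).const_mul Q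
    have h2 := (Real.continuous_exp.tendsto _).comp h0
    simp only [mul_zero, Real.exp_zero] at h2
    have h3 := h2.sub_const 1
    rw [sub_self] at h3
    refine h3.congr fun n => ?_
    simp only [Function.comp_apply, pow_one, hpow]
    ring_nf
  have h2 : Tendsto (fun n : ℕ => (Nat.card (Submodule (ZMod p) (ι → ZMod p)) : ℝ) * (β / 2) ^ n)
      atTop (𝓝 0) := by
    simpa using (tendsto_pow_atTop_nhds_zero_of_lt_one (show 0 ≤ β / 2 by linarith)
      (by linarith)).const_mul (Nat.card (Submodule (ZMod p) (ι → ZMod p)) : ℝ)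
  have h3 : Tendsto (fun n : ℕ => (Nat.card (Submodule (ZMod p) (ι → ZMod p)) : ℝ) *
      (β * (1 - α + Q * θ ^ (η * n))) ^ n) atTop (𝓝 0) := by
    have hlim : Tendsto (fun n : ℕ => β * (1 - α + Q * θ ^ (η * n))) atTop
        (𝓝 (β * (1 - α + Q * 0))) := by
      simp only [hpow]
      exact ((tendsto_pow_atTop_nhds_zero_of_lt_one hr0.le hr1).const_mul Q).const_add _
        |>.const_mul β
    obtain ⟨ρ, hρ0, hρ1⟩ := exists_between (show β * (1 - α + Q * 0) < 1 by
      rw [hβdef]; nlinarith)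
    have hnn (n : ℕ) : 0 ≤ β * (1 - α + Q * θ ^ (η * n)) := by
      have : 0 ≤ Q * θ ^ (η * n) := by positivity
      exact mul_nonneg (by linarith) (by linarith)
    have hρ : 0 ≤ ρ := le_trans (mul_nonneg (by linarith) (by linarith)) hρ0.le
    have hz : Tendsto (fun n : ℕ => (β * (1 - α + Q * θ ^ (η * n))) ^ n) atTop (𝓝 0) := by
      refine squeeze_zero' (Eventually.of_forall fun n => pow_nonneg (hnn n) n) ?_
        (tendsto_pow_atTop_nhds_zero_of_lt_one hρ hρ1)
      filter_upwards [hlim.eventually (gt_mem_nhds hρ0)] with n hn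
      exact pow_le_pow_left₀ (hnn n) hn.le n
    simpa using hz.const_mul (Nat.card (Submodule (ZMod p) (ι → ZMod p)) : ℝ)
  have h4 := (h1.add h2).add h3
  simp only [add_zero] at h4
  rw [tendsto_iff_norm_sub_tendsto_zero]
  refine squeeze_zero' (Eventually.of_forall fun n => norm_nonneg _) ?_ h4
  filter_upwards [eventually_ge_atTop 1] with n hn
  exact abs_expected_card_invariantFrames_sub_one_le (hμ n hn) hθ0 hθ1 (hθ _ (hμ n hn)) ht0 ht1
    hη.le hβ T

end Moments

/-! ### Invariant frames of a diagonal matrix as frames in eigenspaces. -/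

section EigenspaceCounting

open scoped Matrix

variable {p : ℕ} [Fact p.Prime] {n : ℕ}

/-- The number of vectors in the eigenspace of `A` for `a`. -/
noncomputable def eigenspaceCard (A : Matrix (Fin n) (Fin n) (ZMod p)) (a : ZMod p) : ℕ :=
  Nat.card (Module.End.eigenspace (Matrix.toLin' A) a)

/-- The number of linearly independent `r`-tuples in an `𝔽_q`-vector space with `x` elements. -/
def frameCount (q : ℝ) (r : ℕ) (x : ℝ) : ℝ := ∏ i ∈ Finset.range r, (x - q ^ i)

theorem card_linearIndependent_eq_frameCount {W : Type*} [AddCommGroup W] [Module (ZMod p) W]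
    [Finite W] (r : ℕ) :
    (Nat.card {s : Fin r → W // LinearIndependent (ZMod p) s} : ℝ) =
      frameCount p r (Nat.card W) := by
  have := Fintype.ofFinite W
  have hW : Nat.card W = p ^ Module.finrank (ZMod p) W := by
    rw [Nat.card_eq_fintype_card, Module.card_eq_pow_finrank (K := ZMod p), ZMod.card]
  rw [hW]
  by_cases hr : r ≤ Module.finrank (ZMod p) W
  · rw [card_linearIndependent hr, frameCount, Finset.prod_range, ZMod.card]
    push_cast
    refine Finset.prod_congr rfl fun i _ => ?_
    rw [Nat.cast_sub (Nat.pow_le_pow_right (Fact.out : p.Prime).pos (i.2.le.trans hr))]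
    push_cast
    rfl
  -- If `r` exceeds the dimension, the factor of index `finrank` vanishes, so the polynomial formula
  -- remains valid.
  · rw [frameCount, Finset.prod_eq_zero (i := Module.finrank (ZMod p) W)]
    · have : IsEmpty {s : Fin r → W // LinearIndependent (ZMod p) s} :=
        ⟨fun s => hr (by simpa using s.2.fintype_card_le_finrank)⟩
      simp
    · simpa using hr
    · simp

theorem linearIndependent_sigma_eigenspace {K W : Type*} [Field K] [AddCommGroup W] [Module K W]
    (f : Module.End K W) {κ : K → Type*} (v : ∀ a, κ a → W)
    (hv : ∀ a i, v a i ∈ f.eigenspace a) (hli : ∀ a, LinearIndependent K (v a)) :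
    LinearIndependent K fun i : Σ a, κ a => v i.1 i.2 := by
  refine linearIndependent_iUnion_finite hli fun a t _ hat => ?_
  have hle (b : K) : Submodule.span K (Set.range (v b)) ≤ f.eigenspace b :=
    Submodule.span_le.2 (Set.range_subset_iff.2 (hv b))
  refine (f.eigenspaces_iSupIndep.disjoint_biSup hat).mono (hle a) ?_
  exact iSup₂_mono fun b _ => hle b

theorem mul_eq_mul_diagonal_iff {ι : Type*} [Fintype ι] [DecidableEq ι] (t : ι → ZMod p)
    (A : Matrix (Fin n) (Fin n) (ZMod p)) (V : Matrix (Fin n) ι (ZMod p)) :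
    A * V = V * Matrix.diagonal t ↔
      ∀ i, V.col i ∈ Module.End.eigenspace (Matrix.toLin' A) (t i) := by
  simp only [Module.End.mem_eigenspace_iff, Matrix.toLin'_apply, ← Matrix.ext_iff, funext_iff,
    Matrix.mul_diagonal]
  rw [forall_comm]
  refine forall_congr' fun i => forall_congr' fun j => ?_
  rw [Pi.smul_apply, smul_eq_mul, mul_comm (t i)]
  rfl

theorem card_invariantFrames_diagonal (ρ : ZMod p → ℕ) (A : Matrix (Fin n) (Fin n) (ZMod p)) :
    ((invariantFrames (Matrix.diagonal fun i : Σ a, Fin (ρ a) => i.1) A).card : ℝ) =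
      ∏ a, frameCount p (ρ a) (eigenspaceCard A a) := by
  simp only [eigenspaceCard, ← card_linearIndependent_eq_frameCount]
  rw [← Nat.cast_prod, ← Nat.card_pi, ← Nat.card_eq_finsetCard]
  congr 1
  symm
  let W (a : ZMod p) := Module.End.eigenspace (Matrix.toLin' A) a
  have hmem (V : Matrix (Fin n) (Σ a, Fin (ρ a)) (ZMod p)) :
      V ∈ invariantFrames (Matrix.diagonal fun i : Σ a, Fin (ρ a) => i.1) A ↔
        LinearIndependent (ZMod p) V.col ∧ ∀ i, V.col i ∈ W i.1 := by
    rw [mem_invariantFrames, Matrix.mulVec_injective_iff, mul_eq_mul_diagonal_iff]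
  refine Nat.card_eq_of_bijective (fun s => ⟨Matrix.of fun j i => (s i.1).1 i.2 |>.1 j,
    (hmem _).2 ⟨?_, fun i => ((s i.1).1 i.2).2⟩⟩) ⟨fun s s' h => ?_, fun V => ?_⟩
  · exact linearIndependent_sigma_eigenspace (Matrix.toLin' A)
      (fun a i => ((s a).1 i : Fin n → ZMod p)) (fun a i => ((s a).1 i).2)
      fun a => (s a).2.map' (W a).subtype (Submodule.ker_subtype _)
  · funext a
    refine Subtype.ext (funext fun i => Subtype.ext (funext fun j => ?_))
    exact congrFun (congrFun (Subtype.ext_iff.1 h) j) ⟨a, i⟩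
  · obtain ⟨hli, hW⟩ := (hmem V.1).1 V.2
    refine ⟨fun a => ⟨fun i => ⟨V.1.col ⟨a, i⟩, hW ⟨a, i⟩⟩, ?_⟩, Subtype.ext rfl⟩
    exact LinearIndependent.of_comp (W a).subtype (hli.comp (Sigma.mk a) sigma_mk_injective)

theorem isEigenvalueFree_iff (A : Matrix (Fin n) (Fin n) (ZMod p)) :
    IsEigenvalueFree A ↔ ∀ a, eigenspaceCard A a = 1 := by
  refine forall_congr' fun a => ?_
  rw [Module.End.hasEigenvalue_iff, not_not, eigenspaceCard, Nat.card_eq_one_iff_unique,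
    ← Submodule.subsingleton_iff_eq_bot]
  exact ⟨fun h => ⟨h, inferInstance⟩, fun h => h.1⟩

theorem exists_eigenspaceCard_eq_pow (A : Matrix (Fin n) (Fin n) (ZMod p)) (a : ZMod p) :
    ∃ d, eigenspaceCard A a = p ^ d := by
  have := Fintype.ofFinite (Module.End.eigenspace (Matrix.toLin' A) a)
  refine ⟨Module.finrank (ZMod p) (Module.End.eigenspace (Matrix.toLin' A) a), ?_⟩
  rw [eigenspaceCard, Nat.card_eq_fintype_card, Module.card_eq_pow_finrank (K := ZMod p),
    ZMod.card]

end EigenspaceCounting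

/-! ### Bonferroni-type inequalities over `𝔽_q`. -/

section Sieve

/-- The product `(q - 1)(q² - 1)⋯(q^r - 1)`. -/
def qPochhammer (q : ℝ) (r : ℕ) : ℝ := ∏ i ∈ Finset.range r, (q ^ (i + 1) - 1)

theorem qPochhammer_succ (q : ℝ) (r : ℕ) :
    qPochhammer q (r + 1) = qPochhammer q r * (q ^ (r + 1) - 1) := Finset.prod_range_succ _ _

theorem qPochhammer_pos {q : ℝ} (hq : 1 < q) (r : ℕ) : 0 < qPochhammer q r :=
  Finset.prod_pos fun _ _ => sub_pos.2 (one_lt_pow₀ hq (Nat.succ_ne_zero _))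

theorem frameCount_succ (q : ℝ) (r : ℕ) (x : ℝ) :
    frameCount q (r + 1) x = (∏ i ∈ Finset.range r, (x - q ^ (i + 1))) * (x - 1) := by
  rw [frameCount, Finset.prod_range_succ', pow_zero]

theorem frameCount_nonneg {q : ℝ} (hq : 1 < q) (r d : ℕ) : 0 ≤ frameCount q r (q ^ d) := by
  by_cases hd : d < r
  · rw [frameCount, Finset.prod_eq_zero (Finset.mem_range.2 hd) (sub_self _)]
  · refine Finset.prod_nonneg fun i hi => sub_nonneg.2 (pow_le_pow_right₀ hq.le ?_)
    have := Finset.mem_range.1 hi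
    omega

theorem sum_neg_one_pow_mul_frameCount {q : ℝ} (hq : 1 < q) (x : ℝ) (k : ℕ) :
    ∑ r ∈ Finset.range (k + 1), (-1) ^ r / qPochhammer q r * frameCount q r x =
      (-1) ^ k * (∏ i ∈ Finset.range k, (x - q ^ (i + 1))) / qPochhammer q k := by
  induction k with
  | zero => simp [frameCount, qPochhammer]
  | succ k ih =>
    have h1 := (qPochhammer_pos hq k).ne'
    have h2 : q ^ (k + 1) - 1 ≠ 0 := (sub_pos.2 (one_lt_pow₀ hq (Nat.succ_ne_zero _))).ne'
    rw [Finset.sum_range_succ, ih, frameCount_succ, qPochhammer_succ, Finset.prod_range_succ]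
    field_simp
    ring

/-- In the closed form of the partial sum, `d = 0` gives exactly 1 and `1 ≤ d ≤ k` gives 0. For `d >
k` its absolute value is the next term divided by `(q^d - 1) / (q^(k+1) - 1) ≥ 1`. -/
theorem abs_indicator_sub_sum_le {q : ℝ} (hq : 1 < q) (d k : ℕ) :
    |(if q ^ d = 1 then 1 else 0) -
      ∑ r ∈ Finset.range (k + 1), (-1) ^ r / qPochhammer q r * frameCount q r (q ^ d)| ≤
      1 / qPochhammer q (k + 1) * frameCount q (k + 1) (q ^ d) := by
  have h0 : 0 ≤ 1 / qPochhammer q (k + 1) * frameCount q (k + 1) (q ^ d) :=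
    mul_nonneg (one_div_nonneg.2 (qPochhammer_pos hq _).le) (frameCount_nonneg hq _ _)
  have hk := qPochhammer_pos hq k
  rw [sum_neg_one_pow_mul_frameCount hq]
  rcases Nat.eq_zero_or_pos d with rfl | hd
  · have : ∏ i ∈ Finset.range k, (1 - q ^ (i + 1)) = (-1) ^ k * qPochhammer q k := by
      rw [qPochhammer, ← Finset.card_range k, ← Finset.prod_const, Finset.card_range,
        ← Finset.prod_mul_distrib]
      exact Finset.prod_congr rfl fun _ _ => by ring
    rw [pow_zero, this, if_pos rfl, ← mul_assoc, ← mul_pow]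
    simpa [hk.ne'] using h0
  · have hd1 : q ^ d ≠ 1 := (one_lt_pow₀ hq hd.ne').ne'
    rw [if_neg hd1, zero_sub, abs_neg]
    by_cases hdk : d ≤ k
    · rw [Finset.prod_eq_zero (i := d - 1) (Finset.mem_range.2 (by omega))]
      · simpa using h0
      · rw [Nat.sub_add_cancel hd, sub_self]
    · have hprod : 0 ≤ ∏ i ∈ Finset.range k, (q ^ d - q ^ (i + 1)) := by
        refine Finset.prod_nonneg fun i hi => sub_nonneg.2 (pow_le_pow_right₀ hq.le ?_)
        have := Finset.mem_range.1 hi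
        omega
      have h2 : 0 < q ^ (k + 1) - 1 := sub_pos.2 (one_lt_pow₀ hq (Nat.succ_ne_zero _))
      have h3 : q ^ (k + 1) ≤ q ^ d := pow_le_pow_right₀ hq.le (by omega)
      rw [abs_div, abs_mul, abs_pow, abs_neg, abs_one, one_pow, one_mul, abs_of_nonneg hprod,
        abs_of_pos hk, frameCount_succ, qPochhammer_succ, one_div_mul_eq_div,
        div_le_div_iff₀ hk (mul_pos hk h2)]
      nlinarith [mul_le_mul_of_nonneg_left (sub_le_sub_right h3 1) (mul_nonneg hprod hk.le)]

/-- The error is kept as a difference of two products of nonnegative sums, so that it is again a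
combination of mixed frame moments, whose limits are known. -/
theorem abs_prod_sub_prod_le {κ : Type*} (s : Finset κ) {x y z e : κ → ℝ}
    (h1 : ∀ a, |x a - y a| ≤ e a) (h2 : ∀ a, |y a| ≤ z a) :
    |∏ a ∈ s, x a - ∏ a ∈ s, y a| ≤ ∏ a ∈ s, (z a + e a) - ∏ a ∈ s, z a := by
  classical
  have hz (a) : 0 ≤ z a := (abs_nonneg _).trans (h2 a)
  have he (a) : 0 ≤ e a := (abs_nonneg _).trans (h1 a)
  induction s using Finset.induction_on with
  | empty => simp
  | insert a s ha ih =>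
    simp only [Finset.prod_insert ha]
    have hx : |∏ b ∈ s, x b| ≤ ∏ b ∈ s, (z b + e b) := by
      rw [Finset.abs_prod]
      refine Finset.prod_le_prod (fun _ _ => abs_nonneg _) fun b _ => ?_
      have := abs_add_le (y b) (x b - y b)
      rw [add_sub_cancel] at this
      linarith [h1 b, h2 b]
    calc |x a * ∏ b ∈ s, x b - y a * ∏ b ∈ s, y b|
        = |(x a - y a) * ∏ b ∈ s, x b + y a * (∏ b ∈ s, x b - ∏ b ∈ s, y b)| := by ring_nf
      _ ≤ |x a - y a| * |∏ b ∈ s, x b| + |y a| * |∏ b ∈ s, x b - ∏ b ∈ s, y b| := by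
          rw [← abs_mul, ← abs_mul]
          exact abs_add_le _ _
      _ ≤ e a * ∏ b ∈ s, (z b + e b) +
          z a * (∏ b ∈ s, (z b + e b) - ∏ b ∈ s, z b) :=
          add_le_add (mul_le_mul (h1 a) hx (abs_nonneg _) (he a))
            (mul_le_mul (h2 a) ih (abs_nonneg _) (hz a))
      _ = _ := by ring

/-- Allows the truncation level `k` to be sent to infinity after `n`. -/
theorem tendsto_of_abs_sub_le {u : ℕ → ℝ} {a b : ℕ → ℕ → ℝ} {s t : ℕ → ℝ} {L : ℝ}
    (h : ∀ k, ∀ᶠ n in atTop, |u n - a k n| ≤ b k n) (ha : ∀ k, Tendsto (a k) atTop (𝓝 (s k)))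
    (hb : ∀ k, Tendsto (b k) atTop (𝓝 (t k))) (hs : Tendsto s atTop (𝓝 L))
    (ht : Tendsto t atTop (𝓝 0)) : Tendsto u atTop (𝓝 L) := by
  rw [Metric.tendsto_nhds]
  intro ε hε
  obtain ⟨k, hk1, hk2⟩ := ((Metric.tendsto_nhds.1 hs (ε / 3) (by linarith)).and
    (ht.eventually (gt_mem_nhds (show 0 < ε / 3 by linarith)))).exists
  filter_upwards [h k, Metric.tendsto_nhds.1 (ha k) (ε / 3 - dist (s k) L) (by linarith),
    (hb k).eventually (gt_mem_nhds hk2)] with n h1 h2 h3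
  have h4 := dist_triangle4 (u n) (a k n) (s k) L
  rw [← Real.dist_eq] at h1
  linarith

end Sieve

/-! ### Asymptotics of the Euler series as `p → ∞`. -/

section Limit

/-- Makes the tail of `eulerSeries` from `r = 2` on of order `1 / (q - 1)²`, small enough to survive
multiplication by `p`. -/
theorem qPochhammer_add_two_ge {q : ℝ} (hq : 2 ≤ q) (r : ℕ) :
    (q - 1) ^ 2 * 2 ^ r ≤ qPochhammer q (r + 2) := by
  induction r with
  | zero =>
    simp only [qPochhammer, Finset.prod_range_succ, Finset.prod_range_zero]
    have h1 : 0 ≤ (q - 1) * (q - 1) * q :=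
      mul_nonneg (mul_nonneg (by linarith) (by linarith)) (by linarith)
    linarith [show 1 * (q ^ (0 + 1) - 1) * (q ^ (1 + 1) - 1) =
      (q - 1) ^ 2 * 2 ^ 0 + (q - 1) * (q - 1) * q by ring]
  | succ r ih =>
    rw [show r + 1 + 2 = (r + 2) + 1 from rfl, qPochhammer_succ, pow_succ 2, ← mul_assoc]
    have h1 : (2 : ℝ) ^ 2 ≤ q ^ (r + 2 + 1) :=
      (pow_le_pow_left₀ zero_le_two hq 2).trans (pow_le_pow_right₀ (by linarith) (by omega))
    exact mul_le_mul ih (by linarith) zero_le_two (qPochhammer_pos (by linarith) _).le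

theorem one_div_qPochhammer_add_two_le {q : ℝ} (hq : 2 ≤ q) (r : ℕ) :
    1 / qPochhammer q (r + 2) ≤ 1 / (q - 1) ^ 2 * (1 / 2) ^ r := by
  rw [one_div_pow, one_div_mul_one_div]
  exact one_div_le_one_div_of_le (mul_pos (pow_pos (by linarith) 2) (by positivity))
    (qPochhammer_add_two_ge hq r)

theorem summable_one_div_qPochhammer {q : ℝ} (hq : 2 ≤ q) :
    Summable fun r => 1 / qPochhammer q r := by
  rw [← summable_nat_add_iff 2]
  exact Summable.of_nonneg_of_le
    (fun r => one_div_nonneg.2 (qPochhammer_pos (by linarith) _).le)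
    (one_div_qPochhammer_add_two_le hq)
    ((summable_geometric_of_lt_one (by norm_num) (by norm_num)).mul_left _)

theorem norm_neg_one_pow_div_qPochhammer {q : ℝ} (hq : 1 < q) (r : ℕ) :
    ‖(-1) ^ r / qPochhammer q r‖ = 1 / qPochhammer q r := by
  rw [norm_div, norm_pow, norm_neg, norm_one, one_pow,
    Real.norm_of_nonneg (qPochhammer_pos hq r).le]

/-- The alternating series `∑ (-1)^r / ((q - 1)⋯(q^r - 1))`. -/
noncomputable def eulerSeries (q : ℝ) : ℝ := ∑' r, (-1) ^ r / qPochhammer q r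

theorem summable_eulerSeries {q : ℝ} (hq : 2 ≤ q) :
    Summable fun r => (-1) ^ r / qPochhammer q r :=
  .of_norm (by simpa only [norm_neg_one_pow_div_qPochhammer (show 1 < q by linarith)] using
    summable_one_div_qPochhammer hq)

theorem abs_eulerSeries_sub_le {q : ℝ} (hq : 2 ≤ q) :
    |eulerSeries q - (1 - 1 / (q - 1))| ≤ 2 / (q - 1) ^ 2 := by
  have h1 := (summable_eulerSeries hq).sum_add_tsum_nat_add 2
  have h2 : ∑ r ∈ Finset.range 2, (-1) ^ r / qPochhammer q r = 1 - 1 / (q - 1) := by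
    simp [Finset.sum_range_succ, qPochhammer]
    ring
  rw [eulerSeries, ← h1, h2, add_sub_cancel_left, ← Real.norm_eq_abs]
  have hg : HasSum (fun r : ℕ => 1 / (q - 1) ^ 2 * (1 / 2 : ℝ) ^ r) (1 / (q - 1) ^ 2 * 2) :=
    hasSum_geometric_two.mul_left _
  refine (tsum_of_norm_bounded hg fun r => ?_).trans (le_of_eq (by ring))
  rw [norm_neg_one_pow_div_qPochhammer (by linarith)]
  exact one_div_qPochhammer_add_two_le hq r

theorem tendsto_eulerSeries_pow :
    Tendsto (fun p : ℕ => eulerSeries p ^ p) atTop (𝓝 (1 / Real.exp 1)) := by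
  have hz : Tendsto (fun p : ℕ => 1 / ((p : ℝ) - 1)) atTop (𝓝 0) := by
    simp only [one_div]
    exact (tendsto_atTop_add_const_right _ (-1) tendsto_natCast_atTop_atTop).inv_tendsto_atTop
  have hb : Tendsto (fun p : ℕ => 1 / ((p : ℝ) - 1) + 2 * (1 / ((p : ℝ) - 1) +
      1 / ((p : ℝ) - 1) * (1 / ((p : ℝ) - 1)))) atTop (𝓝 0) := by
    simpa using hz.add ((hz.add (hz.mul hz)).const_mul 2)
  have h1 : Tendsto (fun p : ℕ => (p : ℝ) * (eulerSeries p - 1)) atTop (𝓝 (-1)) := by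
    rw [tendsto_iff_norm_sub_tendsto_zero]
    refine squeeze_zero' (Eventually.of_forall fun _ => norm_nonneg _) ?_ hb
    filter_upwards [eventually_ge_atTop 2] with p hp
    have hp2 : (2 : ℝ) ≤ p := by exact_mod_cast hp
    have hp1 : 0 < (p : ℝ) - 1 := by linarith
    have h2 := abs_eulerSeries_sub_le hp2
    have h3 : (p : ℝ) * (eulerSeries p - 1) - -1 =
        p * (eulerSeries p - (1 - 1 / ((p : ℝ) - 1))) - 1 / ((p : ℝ) - 1) := by
      field_simp
      ring
    rw [h3, Real.norm_eq_abs]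
    refine (abs_sub _ _).trans ?_
    rw [abs_mul, abs_of_pos (show (0 : ℝ) < p by linarith), abs_of_pos (one_div_pos.2 hp1)]
    have h4 := mul_le_mul_of_nonneg_left h2 (show (0 : ℝ) ≤ p by linarith)
    have h5 : (p : ℝ) * (2 / ((p : ℝ) - 1) ^ 2) = 2 * (1 / ((p : ℝ) - 1) +
      1 / ((p : ℝ) - 1) * (1 / ((p : ℝ) - 1))) := by
      field_simp
      ring
    linarith
  have h6 := Real.tendsto_one_add_pow_exp_of_tendsto h1
  simp only [add_sub_cancel] at h6
  rwa [one_div, ← Real.exp_neg]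

end Limit

/-! ### Combining moments and sieve. -/

section Main

variable {p : ℕ} [Fact p.Prime] {α : ℝ}

/-- Expanding the product over `a` gives a finite sum over multiplicity functions `ρ`, each with a
mixed moment tending to 1. The limits then factor as if the eigenspaces were independent. -/
theorem tendsto_expected_prod_sum_frameCount (hα : 0 < α) {μ : ℕ → ZMod p → ℝ}
    (hμ : ∀ n, 1 ≤ n → IsBalancedWeight α (μ n)) (w : ℕ → ℝ) (K : ℕ) :
    Tendsto (fun n : ℕ => ∑ A : Matrix (Fin n) (Fin n) (ZMod p), matrixWeight (μ n) A *
      ∏ a, ∑ r ∈ Finset.range K, w r * frameCount p r (eigenspaceCard A a))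
      atTop (𝓝 ((∑ r ∈ Finset.range K, w r) ^ p)) := by
  have h1 (n : ℕ) : ∑ A : Matrix (Fin n) (Fin n) (ZMod p), matrixWeight (μ n) A *
      ∏ a, ∑ r ∈ Finset.range K, w r * frameCount p r (eigenspaceCard A a) =
      ∑ ρ ∈ Fintype.piFinset fun _ : ZMod p => Finset.range K, (∏ a, w (ρ a)) *
        ∑ A : Matrix (Fin n) (Fin n) (ZMod p), matrixWeight (μ n) A *
          (invariantFrames (Matrix.diagonal fun i : Σ a, Fin (ρ a) => i.1) A).card := by
    simp only [Finset.prod_univ_sum, card_invariantFrames_diagonal, Finset.mul_sum,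
      Finset.prod_mul_distrib]
    rw [Finset.sum_comm]
    exact Finset.sum_congr rfl fun ρ _ => Finset.sum_congr rfl fun A _ => by ring
  have h2 : (∑ r ∈ Finset.range K, w r) ^ p =
      ∑ ρ ∈ Fintype.piFinset fun _ : ZMod p => Finset.range K, (∏ a, w (ρ a)) * 1 := by
    have := Finset.prod_univ_sum (fun _ : ZMod p => Finset.range K) fun _ r => w r
    rw [Finset.prod_const, Finset.card_univ, ZMod.card] at this
    simpa using this
  simp only [h1]
  rw [h2]
  exact tendsto_finsetSum _ fun ρ _ =>
    (tendsto_expected_card_invariantFrames hα μ hμ _).const_mul _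

open Classical in
theorem tendsto_sum_matrixWeight_isEigenvalueFree (hα : 0 < α) {μ : ℕ → ZMod p → ℝ}
    (hμ : ∀ n, 1 ≤ n → IsBalancedWeight α (μ n)) :
    Tendsto (fun n : ℕ => ∑ A : Matrix (Fin n) (Fin n) (ZMod p), matrixWeight (μ n) A *
      if IsEigenvalueFree A then 1 else 0) atTop (𝓝 (eulerSeries p ^ p)) := by
  have hp2 : (2 : ℝ) ≤ p := by exact_mod_cast (Fact.out : p.Prime).two_le
  have hp1 : (1 : ℝ) < p := by linarith
  have hS := (summable_eulerSeries hp2).hasSum.tendsto_sum_nat.comp (tendsto_add_atTop_nat 1)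
  have hZ := (summable_one_div_qPochhammer hp2).hasSum.tendsto_sum_nat.comp
    (tendsto_add_atTop_nat 1)
  refine tendsto_of_abs_sub_le (fun k => ?_)
    (fun k => tendsto_expected_prod_sum_frameCount hα hμ (fun r => (-1) ^ r / qPochhammer p r)
      (k + 1))
    (fun k => (tendsto_expected_prod_sum_frameCount hα hμ (fun r => 1 / qPochhammer p r)
      (k + 1 + 1)).sub
      (tendsto_expected_prod_sum_frameCount hα hμ (fun r => 1 / qPochhammer p r) (k + 1)))
    (hS.pow p) ?_
  · filter_upwards [eventually_ge_atTop 1] with n hn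
    rw [← Finset.sum_sub_distrib, ← Finset.sum_sub_distrib]
    refine (Finset.abs_sum_le_sum_abs _ _).trans (Finset.sum_le_sum fun A _ => ?_)
    rw [← mul_sub, ← mul_sub, abs_mul, abs_of_nonneg (matrixWeight_nonneg (hμ n hn) A)]
    refine mul_le_mul_of_nonneg_left ?_ (matrixWeight_nonneg (hμ n hn) A)
    have hfree : (if IsEigenvalueFree A then (1 : ℝ) else 0) =
        ∏ a, if (eigenspaceCard A a : ℝ) = 1 then 1 else 0 := by
      by_cases hA : IsEigenvalueFree A
      · rw [if_pos hA]
        refine (Finset.prod_eq_one fun a _ => if_pos ?_).symm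
        exact_mod_cast (isEigenvalueFree_iff A).1 hA a
      · rw [if_neg hA]
        obtain ⟨a, ha⟩ := not_forall.1 (mt (isEigenvalueFree_iff A).2 hA)
        exact (Finset.prod_eq_zero (Finset.mem_univ a) (if_neg (by exact_mod_cast ha))).symm
    rw [hfree]
    simp only [Finset.sum_range_succ _ (k + 1)]
    have hnn (r : ℕ) : 0 ≤ 1 / qPochhammer (p : ℝ) r :=
      one_div_nonneg.2 (qPochhammer_pos hp1 r).le
    refine abs_prod_sub_prod_le _ (fun a => ?_) fun a => ?_
    · obtain ⟨d, hd⟩ := exists_eigenspaceCard_eq_pow A a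
      rw [hd, Nat.cast_pow]
      exact abs_indicator_sub_sum_le hp1 d k
    · obtain ⟨d, hd⟩ := exists_eigenspaceCard_eq_pow A a
      rw [hd, Nat.cast_pow]
      refine (Finset.abs_sum_le_sum_abs _ _).trans (Finset.sum_le_sum fun r _ => ?_)
      rw [abs_mul, ← Real.norm_eq_abs, norm_neg_one_pow_div_qPochhammer hp1,
        abs_of_nonneg (frameCount_nonneg hp1 r d)]
  -- The limiting truncation error is a difference of `p`-th powers of consecutive partial sums of a
  -- convergent series.
  · have := ((hZ.comp (tendsto_add_atTop_nat 1)).pow p).sub (hZ.pow p)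
    rw [sub_self] at this
    exact this

end Main

theorem theorem1p6 (α : ℝ) (hα : 0 < α) (p₀ : ℕ)
    {Ω : ℕ → ℕ → Type*} [∀ p n, MeasurableSpace (Ω p n)]
    (P : ∀ p n : ℕ, Measure (Ω p n))
    (M : ∀ p n : ℕ, Ω p n → Matrix (Fin n) (Fin n) (ZMod p))
    (hM : ∀ p n : ℕ, p.Prime → p₀ ≤ p → 1 ≤ n → IsIIDBalancedMatrix α (P p n) (M p n)) :
    ∃ L : ℕ → ℝ,
      (∀ p : ℕ, p.Prime → p₀ ≤ p →
        Tendsto (fun n : ℕ => (P p n).real {ω | IsEigenvalueFree (M p n ω)}) atTop (𝓝 (L p))) ∧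
      Tendsto L (atTop ⊓ 𝓟 {p : ℕ | p.Prime}) (𝓝 (1 / Real.exp 1)) := by
  refine ⟨fun p => eulerSeries p ^ p, fun p hp hp₀ => ?_,
    tendsto_eulerSeries_pow.mono_left inf_le_left⟩
  have : Fact p.Prime := ⟨hp⟩
  -- A matrix of size 0 has no entry to take the law from; the value 0 there is irrelevant to the
  -- limit.
  let μ (n : ℕ) (a : ZMod p) : ℝ :=
    if hn : 1 ≤ n then (P p n).real {ω | M p n ω ⟨0, hn⟩ ⟨0, hn⟩ = a} else 0
  have hμ (n : ℕ) (hn : 1 ≤ n) :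
      μ n = fun a => (P p n).real {ω | M p n ω ⟨0, hn⟩ ⟨0, hn⟩ = a} :=
    funext fun a => dif_pos hn
  refine (tendsto_sum_matrixWeight_isEigenvalueFree hα (μ := μ) fun n hn => ?_).congr' ?_
  · rw [hμ n hn]
    exact (hM p n hp hp₀ hn).isBalancedWeight _
  · filter_upwards [eventually_ge_atTop 1] with n hn
    rw [hμ n hn]
    exact ((hM p n hp hp₀ hn).measureReal_setOf ⟨0, hn⟩ IsEigenvalueFree).symm
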